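/- Let $E$ be a real normed space, let $\alpha:[0,1]\to E$ be an injective $C^1$ curve whose derivative $\alpha'$ is not identically zero (one-sided derivatives at the endpoints), and let $\Gamma=\alpha([0,1])\subseteq E$ be its range, with the metric inherited from $E$ and with an arbitrary distinguished point $x_0\in\Gamma$. Let $\operatorname{Lip}_0(\Gamma)$ be the space of all Lipschitz functions $f:\Gamma\to\mathbb{R}$ with $f(x_0)=0$, normed by $$\|f\|=\sup\left\{\frac{|f(q)-f(p)|}{\|q-p\|} : p,q\in\Gamma,\ p\neq q\right\},$$ let $\operatorname{SNA}(\Gamma)\subseteq \operatorname{Lip}_0(\Gamma)$ be the set of those $f$ for which this supremum is a maximum, and let $\overline{\operatorname{SNA}(\Gamma)}$ be its closure in the norm of $\operatorname{Lip}_0(\Gamma)$. Then the set $$(\operatorname{Lip}_0(\Gamma)\setminus\overline{\operatorname{SNA}(\Gamma)})\cup\{0\}$$ contains a linear subspace that is isometrically isomorphic to $\ell_\infty$, the space of bounded real sequences with the supremum norm; that is, there is a linear isometry $T:\ell_\infty\to\operatorname{Lip}_0(\Gamma)$ whose range is contained in this set. -/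

import Mathlib

noncomputable section

/-- The difference quotient `S(f, p, q) = (f q - f p) / d(p, q)`. -/
def lipSlope {M : Type*} [MetricSpace M] (f : M → ℝ) (p q : M) : ℝ :=
  (f q - f p) / dist p q

/-- The real vector space of all Lipschitz functions `f : M → ℝ` with `f x₀ = 0`. -/
def lipZeroSubmodule (M : Type*) [MetricSpace M] (x₀ : M) : Submodule ℝ (M → ℝ) where
  carrier := {f | (∃ K, LipschitzWith K f) ∧ f x₀ = 0}
  zero_mem' := ⟨⟨0, LipschitzWith.const 0⟩, rfl⟩
  add_mem' := by
    rintro f g ⟨⟨K, hf⟩, hf0⟩ ⟨⟨L, hg⟩, hg0⟩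
    exact ⟨⟨K + L, hf.add hg⟩, by simp [hf0, hg0]⟩
  smul_mem' := by
    rintro c f ⟨⟨K, hf⟩, hf0⟩
    exact ⟨⟨‖c‖₊ * K, (lipschitzWith_smul c).comp hf⟩, by simp [hf0]⟩

/-- The space `Lip₀(M)` of the metric space `M` with distinguished point `x₀`. It is a type of
its own so that it carries the Lipschitz norm and not the topology of pointwise convergence. -/
def LipZero (M : Type*) [MetricSpace M] (x₀ : M) : Type _ :=
  ↥(lipZeroSubmodule M x₀)

namespace LipZero

variable {M : Type*} [MetricSpace M] {x₀ : M}

instance : AddCommGroup (LipZero M x₀) :=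
  inferInstanceAs (AddCommGroup ↥(lipZeroSubmodule M x₀))

instance : Module ℝ (LipZero M x₀) :=
  inferInstanceAs (Module ℝ ↥(lipZeroSubmodule M x₀))

instance : CoeFun (LipZero M x₀) (fun _ => M → ℝ) := ⟨fun f => f.1⟩

theorem add_apply (f g : LipZero M x₀) (p : M) : (f + g) p = f p + g p := rfl

theorem smul_apply (c : ℝ) (f : LipZero M x₀) (p : M) : (c • f) p = c * f p := rfl

theorem zero_apply (p : M) : (0 : LipZero M x₀) p = 0 := rfl

theorem ext {f g : LipZero M x₀} (h : ∀ p, f p = g p) : f = g :=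
  Subtype.ext (funext h)

/-- The absolute values of the difference quotients of `f` over all pairs of distinct points. -/
def slopes (f : LipZero M x₀) : Set ℝ :=
  {r | ∃ p q : M, p ≠ q ∧ r = |lipSlope f p q|}

/-- The Lipschitz norm `‖f‖ = sup {|S(f, p, q)| : p ≠ q}`. -/
instance : Norm (LipZero M x₀) := ⟨fun f => sSup (slopes f)⟩

theorem norm_eq (f : LipZero M x₀) : ‖f‖ = sSup (slopes f) := rfl

theorem bddAbove_slopes (f : LipZero M x₀) : BddAbove (slopes f) := by
  obtain ⟨K, hK⟩ := f.2.1
  refine ⟨K, ?_⟩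
  rintro r ⟨p, q, hpq, rfl⟩
  have h := hK.dist_le_mul q p
  rw [Real.dist_eq, dist_comm] at h
  rw [lipSlope, abs_div, abs_of_pos (dist_pos.2 hpq)]
  exact (div_le_iff₀ (dist_pos.2 hpq)).2 h

theorem abs_lipSlope_le_norm (f : LipZero M x₀) {p q : M} (hpq : p ≠ q) :
    |lipSlope f p q| ≤ ‖f‖ :=
  le_csSup (bddAbove_slopes f) ⟨p, q, hpq, rfl⟩

theorem norm_nonneg' (f : LipZero M x₀) : 0 ≤ ‖f‖ := by
  refine Real.sSup_nonneg ?_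
  rintro r ⟨p, q, _, rfl⟩
  exact abs_nonneg _

theorem norm_le_of_forall (f : LipZero M x₀) {C : ℝ} (hC : 0 ≤ C)
    (h : ∀ p q : M, p ≠ q → |lipSlope f p q| ≤ C) : ‖f‖ ≤ C := by
  refine Real.sSup_le ?_ hC
  rintro r ⟨p, q, hpq, rfl⟩
  exact h p q hpq

theorem norm_smul_le' (c : ℝ) (f : LipZero M x₀) : ‖c • f‖ ≤ |c| * ‖f‖ := by
  refine norm_le_of_forall _ (mul_nonneg (abs_nonneg c) (norm_nonneg' f)) fun p q hpq => ?_
  have h : lipSlope (c • f) p q = c * lipSlope f p q := by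
    simp only [lipSlope, smul_apply]
    ring
  rw [h, abs_mul]
  exact mul_le_mul_of_nonneg_left (abs_lipSlope_le_norm f hpq) (abs_nonneg c)

theorem normCore : NormedSpace.Core ℝ (LipZero M x₀) where
  norm_nonneg := norm_nonneg'
  norm_smul c f := by
    rw [Real.norm_eq_abs]
    refine le_antisymm (norm_smul_le' c f) ?_
    rcases eq_or_ne c 0 with rfl | hc
    · simpa using norm_nonneg' ((0 : ℝ) • f)
    · have h := norm_smul_le' c⁻¹ (c • f)
      rw [inv_smul_smul₀ hc, abs_inv] at h
      have hc' : 0 < |c| := abs_pos.2 hc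
      calc |c| * ‖f‖ ≤ |c| * (|c|⁻¹ * ‖c • f‖) := mul_le_mul_of_nonneg_left h hc'.le
        _ = ‖c • f‖ := by rw [← mul_assoc, mul_inv_cancel₀ hc'.ne', one_mul]
  norm_triangle f g := by
    refine norm_le_of_forall _ (add_nonneg (norm_nonneg' f) (norm_nonneg' g)) fun p q hpq => ?_
    have h : lipSlope (f + g) p q = lipSlope f p q + lipSlope g p q := by
      simp only [lipSlope, add_apply]
      ring
    rw [h]
    exact (abs_add_le _ _).trans
      (add_le_add (abs_lipSlope_le_norm f hpq) (abs_lipSlope_le_norm g hpq))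
  norm_eq_zero_iff f := by
    constructor
    · intro h
      refine ext fun p => ?_
      rw [zero_apply]
      rcases eq_or_ne x₀ p with rfl | hp
      · exact f.2.2
      · have h1 := abs_lipSlope_le_norm f hp
        rw [h] at h1
        have h2 : lipSlope f x₀ p = 0 := abs_nonpos_iff.1 h1
        rw [lipSlope, div_eq_zero_iff] at h2
        rcases h2 with h2 | h2
        · rw [sub_eq_zero] at h2
          exact h2.trans f.2.2
        · exact absurd h2 (dist_pos.2 hp).ne'
    · rintro rfl
      refine le_antisymm (norm_le_of_forall _ le_rfl fun p q _ => ?_) (norm_nonneg' _)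
      simp [lipSlope, zero_apply]

instance : NormedAddCommGroup (LipZero M x₀) := NormedAddCommGroup.ofCore normCore

instance : NormedSpace ℝ (LipZero M x₀) := NormedSpace.ofCore normCore

end LipZero

/-- The set `SNA(M)` of strongly norm-attaining functions in `Lip₀(M)`: those for which the
supremum defining the Lipschitz norm is a maximum. -/
def SNA (M : Type*) [MetricSpace M] (x₀ : M) : Set (LipZero M x₀) :=
  {f | ∃ p q : M, p ≠ q ∧ |lipSlope f p q| = ‖f‖}

/-- The Banach space `ℓ_∞` of bounded real sequences with the supremum norm. -/
abbrev EllInfty : Type := lp (fun _ : ℕ => ℝ) ⊤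

/-- The subset `S` of the normed space `Y` contains a linear isometric copy of `X`. -/
def IsometricallyContains {Y : Type*} [NormedAddCommGroup Y] [NormedSpace ℝ Y] (S : Set Y)
    (X : Type*) [NormedAddCommGroup X] [NormedSpace ℝ X] : Prop :=
  ∃ T : X →ₗᵢ[ℝ] Y, Set.range T ⊆ S

end

open MeasureTheory Set Filter Topology

/-! Near a parameter where `α' ≠ 0` the curve is almost straight on small scales: on `[s, t]` the
chord and the arc differ by a proportion controlled by the oscillation of `α'`. Choose a set `A` of
positive measure that leaves gaps in every short `[s, t]`, of a proportion `η` exceeding that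
oscillation (`exists_measurableSet_porous`), and split `A` into pieces `A_n` of positive measure. A
sequence `a` is sent to the function whose derivative along the curve is `a n * ‖α'‖` on `A_n` and
`0` off `A`.

Differentiation at almost every point of `A_n` shows that the norm is at least `|a n|`, so the map
is isometric once its norm is at most `1`. Now let `g` be within `‖a‖ / 4` of the image of `a ≠ 0`,
so that `K = ‖g‖ > 3/4 * ‖a‖`. Off `A` the derivative of `g` is at most `‖a‖ / 4 * ‖α'‖`, hence at
most `K / 2 * ‖α'‖`. The gaps of `A` thus cost `g` more than the chord loses against the arc, and no
close pair attains `K` (`abs_sub_lt_mul_norm_sub`). For the remaining pairs the image of `a` has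
slope at most `‖a‖ / 2`, because `A` lies in a very short interval and `α` is injective; so `g` has
slope at most `3/4 * ‖a‖ < K`. Hence no such `g` attains its norm. -/

theorem abs_sub_le_of_ae_abs_deriv_le {G : ℝ → ℝ} {s t K : ℝ} {A : Set ℝ} (hA : MeasurableSet A)
    (hst : s ≤ t) (hG : AbsolutelyContinuousOnInterval G s t)
    (h₁ : ∀ᵐ u, u ∈ Icc s t → |deriv G u| ≤ K)
    (h₂ : ∀ᵐ u, u ∈ Icc s t → u ∉ A → |deriv G u| ≤ K / 2) :
    |G t - G s| ≤ K * ((t - s) + volume.real (A ∩ Icc s t)) / 2 := by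
  have hi : IntervalIntegrable (A.indicator fun _ => K / 2) volume s t :=
    ⟨(integrable_const (K / 2)).indicator hA, (integrable_const (K / 2)).indicator hA⟩
  have hint : ∫ u in s..t, (K / 2 + A.indicator (fun _ => K / 2) u)
      = K * ((t - s) + volume.real (A ∩ Icc s t)) / 2 := by
    rw [intervalIntegral.integral_add intervalIntegrable_const hi, intervalIntegral.integral_const,
      intervalIntegral.integral_of_le hst, ← integral_Icc_eq_integral_Ioc,
      integral_indicator hA, setIntegral_const, measureReal_restrict_apply hA, smul_eq_mul,
      smul_eq_mul]
    ring
  rw [← hG.integral_deriv_eq_sub, ← hint, ← Real.norm_eq_abs]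
  -- The majorant of `|G'|` is `K / 2` everywhere plus another `K / 2` on `A`.
  refine intervalIntegral.norm_integral_le_of_norm_le hst ?_ (intervalIntegrable_const.add hi)
  filter_upwards [h₁, h₂] with u hu₁ hu₂ hu
  rw [Real.norm_eq_abs]
  by_cases huA : u ∈ A
  · rw [indicator_of_mem huA]
    linarith [hu₁ (Ioc_subset_Icc_self hu)]
  · rw [indicator_of_notMem huA, add_zero]
    exact hu₂ (Ioc_subset_Icc_self hu) huA

/-! ### Porous sets of positive measure -/

/-- The union of the initial segments, of relative length `η`, of the cells of the grid `hℤ`. -/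
def gridGaps (h η : ℝ) : Set ℝ := ⋃ k : ℤ, Icc (k * h) (k * h + η * h)

theorem measurableSet_gridGaps (h η : ℝ) : MeasurableSet (gridGaps h η) :=
  MeasurableSet.iUnion fun _ => measurableSet_Icc

/-- At least `(t - s) / h - 2` whole cells fit into `[s, t]`, which is at least half of `(t - s) /
h` when this ratio is at least `4`. -/
theorem le_volume_gridGaps_inter {h η s t : ℝ} (hh : 0 < h) (hη : 0 ≤ η) (hη' : η < 1)
    (hst : 4 * h ≤ t - s) : η / 2 * (t - s) ≤ volume.real (gridGaps h η ∩ Icc s t) := by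
  set F : Finset ℤ := Finset.Ico ⌈s / h⌉ ⌊t / h⌋ with hF
  have hsub : (⋃ k ∈ F, Icc ((k : ℝ) * h) (k * h + η * h)) ⊆ gridGaps h η ∩ Icc s t := by
    intro x hx
    simp only [mem_iUnion] at hx
    obtain ⟨k, hk, hxk⟩ := hx
    refine ⟨mem_iUnion.2 ⟨k, hxk⟩, ?_, ?_⟩
    · have h1 : s / h ≤ k := Int.ceil_le.1 (Finset.mem_Ico.1 hk).1
      exact ((div_le_iff₀ hh).1 h1).trans hxk.1
    · have h1 : ((k + 1 : ℤ) : ℝ) ≤ t / h := Int.le_floor.1 (Finset.mem_Ico.1 hk).2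
      rw [le_div_iff₀ hh] at h1
      push_cast at h1
      nlinarith [hxk.2]
  have hcard : (t - s) / (2 * h) ≤ (F.card : ℝ) := by
    rw [hF, Int.card_Ico]
    have h1 := Int.ceil_lt_add_one (s / h)
    have h2 := Int.sub_one_lt_floor (t / h)
    have h3 : ((⌊t / h⌋ - ⌈s / h⌉ : ℤ) : ℝ) ≤ ((⌊t / h⌋ - ⌈s / h⌉).toNat : ℝ) := by
      exact_mod_cast Int.self_le_toNat _
    push_cast at h3
    have h4 : 4 ≤ (t - s) / h := (le_div_iff₀ hh).2 hst
    have h5 : (t - s) / (2 * h) = (t - s) / h / 2 := by field_simp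
    have h6 : (t - s) / h = t / h - s / h := sub_div _ _ _
    linarith
  have hvol : volume.real (⋃ k ∈ F, Icc ((k : ℝ) * h) (k * h + η * h)) = F.card * (η * h) := by
    rw [measureReal_biUnion_finset _ (fun _ _ => measurableSet_Icc) (fun _ _ => by simp)]
    · simp [mul_nonneg hη hh.le]
    · intro i _ j _ hij
      refine Set.disjoint_left.2 fun x hxi hxj => hij ?_
      have h1 : (i : ℝ) < j + 1 := by
        by_contra! hc
        nlinarith [hxi.1, hxj.2]
      have h2 : (j : ℝ) < i + 1 := by
        by_contra! hc
        nlinarith [hxj.1, hxi.2]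
      have h3 : i < j + 1 := by exact_mod_cast h1
      have h4 : j < i + 1 := by exact_mod_cast h2
      omega
  have hfin : volume (gridGaps h η ∩ Icc s t) ≠ ⊤ :=
    measure_ne_top_of_subset inter_subset_right (by simp)
  calc η / 2 * (t - s) = (t - s) / (2 * h) * (η * h) := by field_simp
    _ ≤ F.card * (η * h) := mul_le_mul_of_nonneg_right hcard (mul_nonneg hη hh.le)
    _ = _ := hvol.symm
    _ ≤ _ := measureReal_mono hsub hfin

/-- At most `(t - s) / h + 2` cells meet `[s, t]`, and `2 ≤ 2 * (t - s) / h`. -/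
theorem volume_gridGaps_inter_le {h η s t : ℝ} (hh : 0 < h) (hη : 0 ≤ η) (hη' : η < 1)
    (hst : h ≤ t - s) : volume.real (gridGaps h η ∩ Icc s t) ≤ 3 * η * (t - s) := by
  set F : Finset ℤ := Finset.Icc ⌊s / h⌋ ⌊t / h⌋ with hF
  have hsub : gridGaps h η ∩ Icc s t ⊆ ⋃ k ∈ F, Icc ((k : ℝ) * h) (k * h + η * h) := by
    rintro x ⟨hx, hxs, hxt⟩
    obtain ⟨k, hk⟩ := mem_iUnion.1 hx
    refine mem_biUnion (Finset.mem_coe.2 (Finset.mem_Icc.2 ⟨?_, ?_⟩)) hk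
    · refine Int.lt_add_one_iff.1 (Int.floor_lt.2 ?_)
      rw [div_lt_iff₀ hh]
      push_cast
      nlinarith [hk.2]
    · exact Int.le_floor.2 ((le_div_iff₀ hh).2 (hk.1.trans hxt))
  have hcard : (F.card : ℝ) ≤ 3 * (t - s) / h := by
    have h0 : ⌊s / h⌋ ≤ ⌊t / h⌋ := Int.floor_le_floor (by gcongr; linarith)
    have h1 := Int.sub_one_lt_floor (s / h)
    have h2 := Int.floor_le (t / h)
    have h3 : ((F.card : ℤ) : ℝ) = ((⌊t / h⌋ + 1 - ⌊s / h⌋ : ℤ) : ℝ) := by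
      rw [hF, Int.card_Icc, Int.toNat_of_nonneg (by omega)]
    push_cast at h3
    have h4 : 1 ≤ (t - s) / h := (one_le_div hh).2 hst
    have h5 : 3 * (t - s) / h = 3 * ((t - s) / h) := by ring
    have h6 : (t - s) / h = t / h - s / h := sub_div _ _ _
    linarith
  calc volume.real (gridGaps h η ∩ Icc s t)
      ≤ volume.real (⋃ k ∈ F, Icc ((k : ℝ) * h) (k * h + η * h)) :=
        measureReal_mono hsub ((measure_biUnion_lt_top F.finite_toSet (by simp)).ne)
    _ ≤ ∑ k ∈ F, volume.real (Icc ((k : ℝ) * h) (k * h + η * h)) :=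
        measureReal_biUnion_finset_le _ _
    _ = F.card * (η * h) := by simp [mul_nonneg hη hh.le]
    _ ≤ 3 * (t - s) / h * (η * h) := mul_le_mul_of_nonneg_right hcard (mul_nonneg hη hh.le)
    _ = 3 * η * (t - s) := by field_simp

/-- For a requirement `Q h η` that is satisfied, for each `η > 0`, on all small enough scales `h`,
there is a set of positive measure which misses at least the proportion `η` of every short
interval, with an `η` that satisfies the requirement on the scale of that interval. -/
theorem exists_measurableSet_porous {Q : ℝ → ℝ → Prop} (hQ : ∀ η > 0, ∃ h > 0, Q h η)
    (hmono : ∀ {h h' η : ℝ}, h' ≤ h → Q h η → Q h' η) {ρ t₁ t₂ : ℝ} (hρ : Q ρ (1 / 16))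
    (ht : t₁ < t₂) :
    ∃ A : Set ℝ, MeasurableSet A ∧ A ⊆ Icc t₁ t₂ ∧ 0 < volume A ∧
      ∀ s t, s < t → t - s ≤ ρ →
        ∃ η > 0, Q (t - s) η ∧ volume.real (A ∩ Icc s t) ≤ (1 - η) * (t - s) := by
  choose! H hH using hQ
  -- The proportions sum to `1 / 4`, so all grids together remove at most `3 / 4` of `[t₁, t₂]`.
  -- Half of the first one is the `1 / 16` of `hρ`.
  set η : ℕ → ℝ := fun n => 1 / 8 * (1 / 2) ^ n with hη
  have hη0 : ∀ n, 0 < η n := fun n => by positivity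
  have hη1 : ∀ n, η n < 1 := fun n => by
    have : (1 / 2 : ℝ) ^ n ≤ 1 := pow_le_one₀ (by norm_num) (by norm_num)
    simp only [hη]; linarith
  -- The first term makes the scales tend to `0`. The second ensures that intervals too short for
  -- grid `n`, that is, shorter than `4 * h n`, already satisfy the requirement for the proportion
  -- that grid `n + 1` provides.
  set h : ℕ → ℝ := fun n => min ((t₂ - t₁) / (n + 1)) (H (η (n + 1) / 2) / 4) with hh
  have hh0 : ∀ n, 0 < h n := fun n => by
    have h1 := (hH (η (n + 1) / 2) (half_pos (hη0 _))).1
    exact lt_min (div_pos (sub_pos.2 ht) (by positivity)) (by positivity)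
  have hhle : ∀ n, h n ≤ t₂ - t₁ := fun n => by
    refine (min_le_left _ _).trans (div_le_self (sub_pos.2 ht).le ?_)
    linarith [n.cast_nonneg (α := ℝ)]
  have hhQ : ∀ n, Q (4 * h n) (η (n + 1) / 2) := fun n => by
    refine hmono ?_ (hH _ (half_pos (hη0 (n + 1)))).2
    linarith [min_le_right ((t₂ - t₁) / (n + 1)) (H (η (n + 1) / 2) / 4)]
  have hlim : ∀ L > 0, ∃ n, 4 * h n ≤ L := fun L hL => by
    obtain ⟨n, hn⟩ := exists_nat_gt (4 * (t₂ - t₁) / L)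
    refine ⟨n, ?_⟩
    have h1 : h n ≤ (t₂ - t₁) / (n + 1) := min_le_left _ _
    have hn1 : (0 : ℝ) < n + 1 := by positivity
    rw [div_lt_iff₀ hL] at hn
    rw [le_div_iff₀ hn1] at h1
    nlinarith
  refine ⟨Icc t₁ t₂ \ ⋃ n, gridGaps (h n) (η n), measurableSet_Icc.diff
    (MeasurableSet.iUnion fun n => measurableSet_gridGaps _ _), sdiff_subset, ?_, ?_⟩
  · have hsum : HasSum (fun n => 3 * η n * (t₂ - t₁)) (3 / 4 * (t₂ - t₁)) := by
      have := ((hasSum_geometric_two).mul_left (1 / 8 : ℝ)).mul_left 3 |>.mul_right (t₂ - t₁)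
      rwa [show 3 * (1 / 8 * 2) * (t₂ - t₁) = 3 / 4 * (t₂ - t₁) by ring] at this
    have hle : volume (Icc t₁ t₂ ∩ ⋃ n, gridGaps (h n) (η n))
        ≤ ENNReal.ofReal (3 / 4 * (t₂ - t₁)) := by
      rw [inter_iUnion]
      refine (measure_iUnion_le _).trans ?_
      rw [← hsum.tsum_eq, ENNReal.ofReal_tsum_of_nonneg _ hsum.summable]
      · refine ENNReal.tsum_le_tsum fun n => ?_
        rw [inter_comm]
        refine (ENNReal.le_ofReal_iff_toReal_le ?_ ?_).2
          (volume_gridGaps_inter_le (hh0 n) (hη0 n).le (hη1 n) (hhle n))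
        · exact measure_ne_top_of_subset inter_subset_right (by simp)
        · have := hη0 n
          have := sub_pos.2 ht
          positivity
      · intro n
        have := hη0 n
        have := sub_pos.2 ht
        positivity
    rw [pos_iff_ne_zero]
    intro h0
    have h1 := measure_le_inter_add_sdiff volume (Icc t₁ t₂) (⋃ n, gridGaps (h n) (η n))
    rw [h0, add_zero, Real.volume_Icc] at h1
    have h2 := (ENNReal.ofReal_le_ofReal_iff (by linarith)).1 (h1.trans hle)
    linarith
  · intro s t hst hstρ
    classical
    have hex := hlim (t - s) (sub_pos.2 hst)
    -- The coarsest usable grid: its gaps give the volume bound, and failure of the preceding grid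
    -- gives `Q`.
    set n := Nat.find hex with hn
    refine ⟨η n / 2, half_pos (hη0 n), ?_, ?_⟩
    · rcases Nat.eq_zero_or_pos n with h0 | h0
      · rw [h0]
        refine hmono hstρ ?_
        convert hρ using 1
        norm_num [hη]
      · obtain ⟨m, hm⟩ := Nat.exists_eq_succ_of_ne_zero h0.ne'
        rw [hm]
        refine hmono ?_ (hhQ m)
        exact (not_le.1 (Nat.find_min hex (m := m) (by omega))).le
    · have h1 := le_volume_gridGaps_inter (hh0 n) (hη0 n).le (hη1 n) (Nat.find_spec hex)
      have hfin : volume (Icc s t) ≠ ⊤ := by simp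
      have h2 : volume.real ((Icc t₁ t₂ \ ⋃ n, gridGaps (h n) (η n)) ∩ Icc s t)
          ≤ volume.real (Icc s t \ gridGaps (h n) (η n)) := by
        refine measureReal_mono ?_ (measure_ne_top_of_subset sdiff_subset hfin)
        rintro x ⟨⟨_, hx⟩, hx'⟩
        exact ⟨hx', fun h => hx (mem_iUnion.2 ⟨n, h⟩)⟩
      have h3 := measureReal_inter_add_sdiff (μ := volume) (s := Icc s t)
        (measurableSet_gridGaps (h n) (η n)) hfin
      rw [Real.volume_real_Icc_of_le hst.le, inter_comm] at h3
      linarith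

/-- A set of positive finite Lebesgue measure splits into countably many pieces of positive
measure. -/
theorem exists_measurable_nat_fibers_pos {A : Set ℝ} (hA : MeasurableSet A) (hpos : 0 < volume A)
    {t₁ t₂ : ℝ} (hA' : A ⊆ Icc t₁ t₂) :
    ∃ idx : ℝ → ℕ, Measurable idx ∧ ∀ n, 0 < volume (A ∩ idx ⁻¹' {n}) := by
  have hfin : ∀ s, volume (A ∩ s) ≠ ⊤ := fun s =>
    measure_ne_top_of_subset (inter_subset_left.trans hA') (by simp)
  set F : ℝ → ℝ := fun x => volume.real (A ∩ Iic x) with hF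
  have hadd : ∀ x y, x ≤ y → F y = F x + volume.real (A ∩ Ioc x y) := fun x y hxy => by
    rw [hF]
    dsimp only
    rw [← Iic_union_Ioc_eq_Iic hxy, inter_union_distrib_left,
      measureReal_union _ (hA.inter measurableSet_Ioc) (hfin _) (hfin _)]
    exact ((Iic_disjoint_Ioc le_rfl).mono inter_subset_right inter_subset_right)
  have hFmono : Monotone F := fun x y hxy => by
    rw [hadd x y hxy]
    exact le_add_of_nonneg_right measureReal_nonneg
  have hFcont : Continuous F := by
    refine (LipschitzWith.of_le_add fun x y => ?_).continuous
    rcases le_total x y with hxy | hxy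
    · exact (hFmono hxy).trans (le_add_of_nonneg_right dist_nonneg)
    · rw [hadd y x hxy, Real.dist_eq, abs_of_nonneg (sub_nonneg.2 hxy)]
      have h1 : volume.real (A ∩ Ioc y x) ≤ volume.real (Ioc y x) :=
        measureReal_mono inter_subset_right (by simp)
      rw [Real.volume_real_Ioc_of_le hxy] at h1
      linarith
  set V := volume.real A with hV
  have hV0 : 0 < V := ENNReal.toReal_pos hpos.ne' (by simpa using hfin univ)
  have hF1 : F t₁ = 0 := by
    refine (measureReal_eq_zero_iff (hfin _)).2 (measure_mono_null (t := {t₁}) ?_ (by simp))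
    exact fun x hx => le_antisymm hx.2 (hA' hx.1).1
  have hF2 : F t₂ = V := by
    rw [hF, hV]
    dsimp only
    rw [inter_eq_left.2 (show A ⊆ Iic t₂ from fun x hx => (hA' hx).2)]
  have ht : t₁ ≤ t₂ := by
    obtain ⟨x, hx⟩ := nonempty_of_measure_ne_zero hpos.ne'
    exact (hA' hx).1.trans (hA' hx).2
  have hsurj : ∀ v, 0 ≤ v → v ≤ V → ∃ x, F x = v := fun v h0 h1 => by
    obtain ⟨x, _, hx⟩ := intermediate_value_Icc ht hFcont.continuousOn
      (show v ∈ Icc (F t₁) (F t₂) by rw [hF1, hF2]; exact ⟨h0, h1⟩)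
    exact ⟨x, hx⟩
  -- Piece `n` contains the points with `V / (n + 2) < F x ≤ V / (n + 1)`. Where `F x = 0`, division
  -- by zero and truncated subtraction give index `0`, which is harmless.
  refine ⟨fun x => ⌊V / F x⌋₊ - 1, ?_, fun n => ?_⟩
  · exact (measurable_from_top (f := fun k : ℕ => k - 1)).comp
      (Nat.measurable_floor.comp (hFcont.measurable.const_div V))
  · have hn : (0 : ℝ) ≤ n := n.cast_nonneg
    have hlt : V / (n + 3 / 2) < V / (n + 1) := by gcongr; linarith
    -- Any value strictly between `V / (n + 2)` and `V / (n + 1)` would do; it keeps the floor equal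
    -- to `n + 1` at both ends.
    obtain ⟨x, hx⟩ := hsurj (V / (n + 3 / 2)) (by positivity)
      (div_le_self hV0.le (by linarith))
    obtain ⟨y, hy⟩ := hsurj (V / (n + 1)) (by positivity) (div_le_self hV0.le (by linarith))
    have hxy : x ≤ y := by
      by_contra! hc
      have := hFmono hc.le
      linarith
    have h1 : 0 < volume.real (A ∩ Ioc x y) := by
      have := hadd x y hxy
      linarith
    refine (ENNReal.toReal_pos_iff.1 h1).1.trans_le (measure_mono ?_)
    rintro u ⟨huA, hu⟩
    refine ⟨huA, ?_⟩
    have h2 : V / (n + 3 / 2) ≤ F u := hx ▸ hFmono hu.1.le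
    have h3 : F u ≤ V / (n + 1) := hy ▸ hFmono hu.2
    have h0 : 0 < F u := lt_of_lt_of_le (by positivity) h2
    have h4 : ⌊V / F u⌋₊ = n + 1 := by
      rw [Nat.floor_eq_iff (by positivity), le_div_iff₀ h0, div_lt_iff₀ h0]
      rw [div_le_iff₀ (by positivity)] at h2
      rw [le_div_iff₀ (by positivity)] at h3
      push_cast
      constructor <;> nlinarith
    simp [h4]

/-- Pass to the limit in the slopes of both functions. This turns Lipschitz bounds along the curve
into bounds on derivatives with respect to the parameter. -/
theorem norm_deriv_le_of_norm_sub_le {E F : Type*} [NormedAddCommGroup E] [NormedSpace ℝ E]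
    [NormedAddCommGroup F] [NormedSpace ℝ F] {α : ℝ → E} {G : ℝ → F} {a : E} {y : F} {u K : ℝ}
    (hα : HasDerivAt α a u) (hG : HasDerivAt G y u)
    (h : ∀ᶠ v in 𝓝 u, ‖G v - G u‖ ≤ K * ‖α v - α u‖) : ‖y‖ ≤ K * ‖a‖ := by
  refine le_of_tendsto_of_tendsto (hasDerivAt_iff_tendsto_slope.1 hG).norm
    ((hasDerivAt_iff_tendsto_slope.1 hα).norm.const_mul K) ?_
  filter_upwards [nhdsWithin_le_nhds h] with v hv
  rw [slope_def_module, slope_def_module, norm_smul, norm_smul, mul_left_comm]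
  exact mul_le_mul_of_nonneg_left hv (norm_nonneg _)

/-! ### The almost straight part of the curve -/

section Curve

variable {E : Type*} [NormedAddCommGroup E] [NormedSpace ℝ E]

/-- If `|G'| ≤ K ‖α'‖` and, off a set `A` of density less than `1`, even `|G'| ≤ K / 2 * ‖α'‖`,
then on an interval on which `α` is almost straight the increment of `G` is less than `K` times
the chord. -/
theorem abs_sub_lt_mul_norm_sub {α : ℝ → E} {G : ℝ → ℝ} {A : Set ℝ} {s t m η K : ℝ}
    (hA : MeasurableSet A) (hst : s < t) (hα : ∀ u ∈ Icc s t, HasDerivAt α (deriv α u) u)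
    (hη : 0 < η) (hm : 0 < m) (hms : m ≤ ‖deriv α s‖)
    (hosc : ∀ u ∈ Icc s t, ‖deriv α u - deriv α s‖ ≤ η * (m / 16))
    (hvol : volume.real (A ∩ Icc s t) ≤ (1 - η) * (t - s))
    (hG : AbsolutelyContinuousOnInterval G s t) (hK : 0 < K)
    (h₁ : ∀ᵐ u, u ∈ Icc s t → |deriv G u| ≤ K * ‖deriv α u‖)
    (h₂ : ∀ᵐ u, u ∈ Icc s t → u ∉ A → |deriv G u| ≤ K / 2 * ‖deriv α u‖) :
    |G t - G s| < K * ‖α t - α s‖ := by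
  set M := ‖deriv α s‖ with hM
  set e := η * (m / 16) with he
  have hst' : 0 < t - s := sub_pos.2 hst
  have hle : ∀ u ∈ Icc s t, ‖deriv α u‖ ≤ M + e := fun u hu => by
    have := norm_le_norm_add_norm_sub' (deriv α u) (deriv α s)
    linarith [hosc u hu]
  have h3 : |G t - G s| ≤ K * (M + e) * ((t - s) + volume.real (A ∩ Icc s t)) / 2 := by
    refine abs_sub_le_of_ae_abs_deriv_le hA hst.le hG ?_ ?_
    · filter_upwards [h₁] with u hu hu'
      exact (hu hu').trans (mul_le_mul_of_nonneg_left (hle u hu') hK.le)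
    · filter_upwards [h₂] with u hu hu' huA
      refine (hu hu' huA).trans ?_
      rw [mul_div_right_comm]
      exact mul_le_mul_of_nonneg_left (hle u hu') (half_pos hK).le
  -- Mean value inequality for the deviation `u ↦ α u - u • α'(s)` from the tangent line.
  have h4 : (M - e) * (t - s) ≤ ‖α t - α s‖ := by
    have h5 := norm_image_sub_le_of_norm_deriv_le_segment'
      (f := fun u => α u - u • deriv α s) (f' := fun u => deriv α u - (1 : ℝ) • deriv α s) (C := e)
      (fun u hu => ((hα u hu).sub ((hasDerivAt_id u).smul_const _)).hasDerivWithinAt)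
      (fun u hu => by simpa using hosc u (Ico_subset_Icc_self hu)) t (right_mem_Icc.2 hst.le)
    have h6 : (t - s) • deriv α s
        = (α t - α s) - ((α t - t • deriv α s) - (α s - s • deriv α s)) := by
      rw [sub_smul]; abel
    have h7 := norm_sub_le (α t - α s) ((α t - t • deriv α s) - (α s - s • deriv α s))
    rw [← h6, norm_smul, Real.norm_of_nonneg hst'.le] at h7
    linarith
  have hMe : 0 < M + e := by positivity
  calc |G t - G s| ≤ K * (M + e) * ((t - s) + volume.real (A ∩ Icc s t)) / 2 := h3
    _ ≤ K * (M + e) * ((t - s) + (1 - η) * (t - s)) / 2 := by gcongr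
    _ = K * (((M + e) * (1 - η / 2)) * (t - s)) := by ring
    _ < K * ((M - e) * (t - s)) := by
        -- The gaps win: `2 * e = η * m / 8` is less than the gain `η / 2 * (M + e)`, since `m ≤ M`.
        refine mul_lt_mul_of_pos_left (mul_lt_mul_of_pos_right ?_ hst') hK
        have h8 : η * m ≤ η * M := mul_le_mul_of_nonneg_left hms hη.le
        have h9 : 0 < η * m := mul_pos hη hm
        have h10 : 0 < η * e := by positivity
        nlinarith
    _ ≤ K * ‖α t - α s‖ := mul_le_mul_of_nonneg_left h4 hK.le

/-- A set `A` in the parameter interval of a curve, divided by `idx` into countably many pieces of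
positive measure, which leaves gaps of a proportion that exceeds the oscillation of the
derivative, and which is too short to matter for far away points of the curve. -/
structure PorousSet (α : ℝ → E) where
  (c d m M ρ t₁ t₂ : ℝ)
  A : Set ℝ
  idx : ℝ → ℕ
  c_pos : 0 < c
  d_lt_one : d < 1
  m_pos : 0 < m
  c_add_le : c + ρ ≤ t₁
  add_le_d : t₂ + ρ ≤ d
  t₁_lt_t₂ : t₁ < t₂
  ρ_pos : 0 < ρ
  lipschitz : ∃ L, LipschitzOnWith L α (Icc 0 1)
  hasDerivAt : ∀ u ∈ Icc c d, HasDerivAt α (deriv α u) u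
  continuousOn_deriv : ContinuousOn (deriv α) (Icc c d)
  m_le : ∀ u ∈ Icc c d, m ≤ ‖deriv α u‖
  le_M : ∀ u ∈ Icc c d, ‖deriv α u‖ ≤ M
  far : ∀ s ∈ Icc (0 : ℝ) 1, ∀ t ∈ Icc (0 : ℝ) 1, ρ < t - s → 2 * M * (t₂ - t₁) ≤ ‖α t - α s‖
  measurableSet : MeasurableSet A
  subset : A ⊆ Icc t₁ t₂
  measurable_idx : Measurable idx
  volume_pos : ∀ n, 0 < volume (A ∩ idx ⁻¹' {n})
  porous : ∀ s ∈ Icc c d, ∀ t ∈ Icc c d, s < t → t - s ≤ ρ → ∃ η > 0,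
    (∀ u ∈ Icc s t, ‖deriv α u - deriv α s‖ ≤ η * (m / 16)) ∧
      volume.real (A ∩ Icc s t) ≤ (1 - η) * (t - s)

/-- Uniform continuity of `α'` near a point where it does not vanish supplies the oscillation
requirement for the porous set; injectivity and compactness bound the chords of far pairs from
below. -/
theorem nonempty_porousSet {α : ℝ → E} (hα : ContDiffOn ℝ 1 α (Icc 0 1))
    (hinj : InjOn α (Icc 0 1))
    (hderiv : ∃ t ∈ Icc (0 : ℝ) 1, derivWithin α (Icc 0 1) t ≠ 0) : Nonempty (PorousSet α) := by
  have hcont : ContinuousOn (derivWithin α (Icc 0 1)) (Icc 0 1) :=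
    hα.continuousOn_derivWithin (uniqueDiffOn_Icc_zero_one) le_rfl
  have hderivW : ∀ u ∈ Ioo (0 : ℝ) 1, HasDerivAt α (derivWithin α (Icc 0 1) u) u := fun u hu =>
    ((hα.differentiableOn one_ne_zero) u (Ioo_subset_Icc_self hu)).hasDerivWithinAt.hasDerivAt
      (Icc_mem_nhds hu.1 hu.2)
  have heq : ∀ u ∈ Ioo (0 : ℝ) 1, deriv α u = derivWithin α (Icc 0 1) u := fun u hu =>
    (hderivW u hu).deriv
  have hcont' : ContinuousOn (deriv α) (Ioo 0 1) :=
    (hcont.mono Ioo_subset_Icc_self).congr heq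
  -- By continuity, a derivative vanishing on the open interval would vanish at the endpoints too.
  obtain ⟨t₀, ht₀, hne⟩ : ∃ t ∈ Ioo (0 : ℝ) 1, deriv α t ≠ 0 := by
    by_contra! hc
    obtain ⟨t, ht, hne⟩ := hderiv
    refine hne ?_
    have h1 : EqOn (derivWithin α (Icc 0 1)) (fun _ => 0) (Ioo 0 1) := fun u hu =>
      (heq u hu).symm.trans (hc u hu)
    exact h1.of_subset_closure hcont continuousOn_const Ioo_subset_Icc_self
      (closure_Ioo zero_ne_one).ge ht
  set m := ‖deriv α t₀‖ / 2 with hm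
  have hm0 : 0 < m := half_pos (norm_pos_iff.2 hne)
  obtain ⟨r, hr, hball⟩ : ∃ r > 0, Metric.closedBall t₀ r ⊆ Ioo 0 1 ∩ {u | m < ‖deriv α u‖} := by
    refine Metric.nhds_basis_closedBall.mem_iff.1 (Filter.inter_mem (Ioo_mem_nhds ht₀.1 ht₀.2) ?_)
    exact ((hcont'.continuousAt (Ioo_mem_nhds ht₀.1 ht₀.2)).norm).eventually
      (lt_mem_nhds (half_lt_self (norm_pos_iff.2 hne)))
  rw [Real.closedBall_eq_Icc] at hball
  have hsub : Icc (t₀ - r) (t₀ + r) ⊆ Ioo 0 1 := fun u hu => (hball hu).1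
  have hcr := hcont'.mono hsub
  obtain ⟨M, hM⟩ := isCompact_Icc.exists_bound_of_continuousOn hcr
  have hM0 : 0 < M := (norm_pos_iff.2 hne).trans_le (hM t₀ ⟨by linarith, by linarith⟩)
  set Q : ℝ → ℝ → Prop := fun h η => ∀ s ∈ Icc (t₀ - r) (t₀ + r), ∀ u ∈ Icc (t₀ - r) (t₀ + r),
    |u - s| ≤ h → ‖deriv α u - deriv α s‖ ≤ η * (m / 16) with hQdef
  have hmono : ∀ {h h' η : ℝ}, h' ≤ h → Q h η → Q h' η := fun hh hQ s hs u hu hus =>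
    hQ s hs u hu (hus.trans hh)
  have hQ : ∀ η > 0, ∃ h > 0, Q h η := fun η hη => by
    obtain ⟨δ, hδ, hδ'⟩ := Metric.uniformContinuousOn_iff.1
      (isCompact_Icc.uniformContinuousOn_of_continuous hcr) (η * (m / 16)) (by positivity)
    refine ⟨δ / 2, half_pos hδ, fun s hs u hu hus => ?_⟩
    rw [← dist_eq_norm]
    exact (hδ' u hu s hs (by rw [Real.dist_eq]; linarith)).le
  obtain ⟨h₀, hh₀, hQh₀⟩ := hQ (1 / 16) (by norm_num)
  set ρ := min h₀ (r / 2) with hρ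
  have hρ0 : 0 < ρ := lt_min hh₀ (half_pos hr)
  have hρr : ρ ≤ r / 2 := min_le_right _ _
  obtain ⟨κ, hκ, hκ'⟩ : ∃ κ, 0 < κ ∧ ∀ p ∈ (Icc (0 : ℝ) 1 ×ˢ Icc (0 : ℝ) 1) ∩
      {p : ℝ × ℝ | ρ ≤ p.2 - p.1}, κ ≤ ‖α p.2 - α p.1‖ := by
    refine IsCompact.exists_forall_le' ((isCompact_Icc.prod isCompact_Icc).inter_right
      (isClosed_le continuous_const (continuous_snd.sub continuous_fst))) ?_ ?_
    · refine ContinuousOn.norm (ContinuousOn.sub ?_ ?_)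
      · exact hα.continuousOn.comp continuousOn_snd fun p hp => hp.1.2
      · exact hα.continuousOn.comp continuousOn_fst fun p hp => hp.1.1
    · rintro p ⟨⟨hp1, hp2⟩, hp⟩
      refine norm_pos_iff.2 (sub_ne_zero.2 fun he => ?_)
      have h1 : p.2 = p.1 := hinj hp2 hp1 he
      have h2 : ρ ≤ p.2 - p.1 := hp
      linarith
  -- The bound `r / 4` keeps the `ρ`-neighbourhood of `[t₀, t₀ + l]` in the good interval; `κ / (2 *
  -- M)` holds the total increment of a primitive to half of `‖a‖` times any far chord.
  set l := min (r / 4) (κ / (2 * M)) with hl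
  have hl0 : 0 < l := lt_min (by positivity) (by positivity)
  have hlr : l ≤ r / 4 := min_le_left _ _
  have hlκ : 2 * M * l ≤ κ := by
    rw [← le_div_iff₀' (by positivity)]
    exact min_le_right _ _
  obtain ⟨A, hA, hAs, hA0, hAp⟩ := exists_measurableSet_porous hQ hmono
    (hmono (min_le_left h₀ (r / 2)) hQh₀) (t₁ := t₀) (t₂ := t₀ + l) (by linarith)
  obtain ⟨idx, hidx, hpos⟩ := exists_measurable_nat_fibers_pos hA hA0 hAs
  exact ⟨{
    c := t₀ - r, d := t₀ + r, m := m, M := M, ρ := ρ, t₁ := t₀, t₂ := t₀ + l, A := A, idx := idx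
    c_pos := (hsub ⟨le_rfl, by linarith⟩).1
    d_lt_one := (hsub ⟨by linarith, le_rfl⟩).2
    m_pos := hm0
    c_add_le := by linarith
    add_le_d := by linarith
    t₁_lt_t₂ := by linarith
    ρ_pos := hρ0
    lipschitz := hα.exists_lipschitzOnWith one_ne_zero (convex_Icc _ _) isCompact_Icc
    hasDerivAt := fun u hu => (hderivW u (hsub hu)).differentiableAt.hasDerivAt
    continuousOn_deriv := hcr
    m_le := fun u hu => (hball hu).2.le
    le_M := hM
    far := fun s hs t ht hst => by
      rw [add_sub_cancel_left]
      exact hlκ.trans (hκ' (s, t) ⟨⟨hs, ht⟩, hst.le⟩)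
    measurableSet := hA
    subset := hAs
    measurable_idx := hidx
    volume_pos := hpos
    porous := fun s hs t ht hst hstρ => by
      obtain ⟨η, hη, hηQ, hηv⟩ := hAp s t hst hstρ
      refine ⟨η, hη, fun u hu => hηQ s hs u ⟨hs.1.trans hu.1, hu.2.trans ht.2⟩ ?_, hηv⟩
      rw [abs_of_nonneg (sub_nonneg.2 hu.1)]
      linarith [hu.2] }⟩

/-! ### The functions on the curve and their Lipschitz estimates -/

namespace PorousSet

variable {α : ℝ → E} (P : PorousSet α)

/-- The density which defines the function on the curve that belongs to the sequence `a`. -/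
noncomputable def density (a : EllInfty) : ℝ → ℝ := P.A.indicator fun u => a (P.idx u) * ‖deriv α u‖

/-- The primitive of the density of the sequence `a`. -/
noncomputable def primitive (a : EllInfty) (x : ℝ) : ℝ := ∫ u in (0 : ℝ)..x, P.density a u

theorem A_subset : P.A ⊆ Icc P.c P.d := P.subset.trans <| Icc_subset_Icc
  (by linarith [P.c_add_le, P.ρ_pos]) (by linarith [P.add_le_d, P.ρ_pos])

theorem M_pos : 0 < P.M := P.m_pos.trans_le <| by
  have h : P.t₁ ∈ Icc P.c P.d := ⟨by linarith [P.c_add_le, P.ρ_pos],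
    by linarith [P.add_le_d, P.ρ_pos, P.t₁_lt_t₂]⟩
  exact (P.m_le _ h).trans (P.le_M _ h)

theorem abs_density_le (a : EllInfty) (u : ℝ) : |P.density a u| ≤ ‖a‖ * ‖deriv α u‖ := by
  rw [density]
  by_cases hu : u ∈ P.A
  · rw [indicator_of_mem hu, abs_mul, abs_norm]
    exact mul_le_mul_of_nonneg_right (lp.norm_apply_le_norm (by simp) a _) (norm_nonneg _)
  · rw [indicator_of_notMem hu, abs_zero]
    positivity

theorem norm_density_le (a : EllInfty) (u : ℝ) :
    ‖P.density a u‖ ≤ (Icc P.t₁ P.t₂).indicator (fun _ => ‖a‖ * P.M) u := by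
  by_cases hu : u ∈ P.A
  · rw [indicator_of_mem (P.subset hu)]
    exact (P.abs_density_le a u).trans
      (mul_le_mul_of_nonneg_left (P.le_M u (P.A_subset hu)) (norm_nonneg a))
  · rw [density, indicator_of_notMem hu, norm_zero]
    exact indicator_nonneg (fun _ _ => mul_nonneg (norm_nonneg a) P.M_pos.le) u

theorem integrable_bound (K : ℝ) : Integrable ((Icc P.t₁ P.t₂).indicator fun _ => K) :=
  (integrable_indicator_iff measurableSet_Icc).2 (by simp)

theorem integrable_density (a : EllInfty) : Integrable (P.density a) := by
  refine (P.integrable_bound (‖a‖ * P.M)).mono' ?_ (ae_of_all _ (P.norm_density_le a))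
  refine (aestronglyMeasurable_indicator_iff P.measurableSet).2 (.mul ?_ ?_)
  · exact ((measurable_from_top (f := fun n : ℕ => a n)).comp
      P.measurable_idx).aestronglyMeasurable
  · exact (P.continuousOn_deriv.norm.aestronglyMeasurable measurableSet_Icc).mono_set P.A_subset

theorem primitive_sub (a : EllInfty) (s t : ℝ) :
    P.primitive a t - P.primitive a s = ∫ u in s..t, P.density a u :=
  intervalIntegral.integral_interval_sub_left (P.integrable_density a).intervalIntegrable
    (P.integrable_density a).intervalIntegrable

theorem abs_primitive_sub_le (a : EllInfty) {s t : ℝ} (hst : s ≤ t) :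
    |P.primitive a t - P.primitive a s| ≤ ‖a‖ * P.M * (P.t₂ - P.t₁) := by
  rw [primitive_sub, ← Real.norm_eq_abs]
  refine (intervalIntegral.norm_integral_le_of_norm_le hst
    (ae_of_all _ fun u _ => P.norm_density_le a u)
    (P.integrable_bound _).intervalIntegrable).trans ?_
  rw [intervalIntegral.integral_of_le hst]
  refine (setIntegral_le_integral (P.integrable_bound _) (ae_of_all _ ?_)).trans ?_
  · exact indicator_nonneg fun _ _ => mul_nonneg (norm_nonneg a) P.M_pos.le
  · rw [integral_indicator measurableSet_Icc, setIntegral_const, Real.volume_real_Icc_of_le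
      P.t₁_lt_t₂.le, smul_eq_mul, mul_comm]

theorem lipschitzWith_primitive (a : EllInfty) :
    LipschitzWith (‖a‖ * P.M).toNNReal (P.primitive a) := by
  refine LipschitzWith.of_dist_le_mul fun t s => ?_
  rw [Real.dist_eq, Real.dist_eq, primitive_sub, ← Real.norm_eq_abs,
    Real.coe_toNNReal _ (mul_nonneg (norm_nonneg a) P.M_pos.le)]
  refine intervalIntegral.norm_integral_le_of_norm_le_const fun u _ => ?_
  refine (P.norm_density_le a u).trans (indicator_le_self' (fun _ _ => ?_) u)
  exact mul_nonneg (norm_nonneg a) P.M_pos.le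

theorem primitive_eq (a : EllInfty) {s t : ℝ} (hst : s ≤ t) (h : t < P.t₁ ∨ P.t₂ < s) :
    P.primitive a t = P.primitive a s := by
  rw [← sub_eq_zero, primitive_sub]
  refine intervalIntegral.integral_zero_ae (ae_of_all _ fun u hu => ?_)
  rw [uIoc_of_le hst] at hu
  refine indicator_of_notMem (fun huA => ?_) _
  have := P.subset huA
  rcases h with h | h
  · linarith [hu.2, this.1]
  · linarith [hu.1, this.2]

theorem ae_hasDerivAt_primitive (a : EllInfty) :
    ∀ᵐ u, HasDerivAt (P.primitive a) (P.density a u) u := by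
  filter_upwards [LocallyIntegrable.ae_hasDerivAt_integral
    (P.integrable_density a).locallyIntegrable] with u hu using hu 0

theorem primitive_add (a b : EllInfty) : P.primitive (a + b) = P.primitive a + P.primitive b := by
  ext x
  simp only [primitive, Pi.add_apply]
  rw [← intervalIntegral.integral_add (P.integrable_density a).intervalIntegrable
    (P.integrable_density b).intervalIntegrable]
  congr 1 with u
  by_cases hu : u ∈ P.A <;> simp [density, hu, add_mul]

theorem primitive_smul (k : ℝ) (a : EllInfty) : P.primitive (k • a) = k • P.primitive a := by
  ext x
  simp only [primitive, Pi.smul_apply, smul_eq_mul]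
  rw [← intervalIntegral.integral_const_mul]
  congr 1 with u
  by_cases hu : u ∈ P.A <;> simp [density, hu, mul_assoc]

theorem Icc_subset : Icc P.c P.d ⊆ Ioo 0 1 := fun _ hu =>
  ⟨P.c_pos.trans_le hu.1, hu.2.trans_lt P.d_lt_one⟩

/-- Points of the curve, other than those in the almost straight part that are close to each
other, see at most half of the allowed increment of the primitive. -/
theorem near_or_abs_primitive_sub_le (a : EllInfty) {s t : ℝ} (hs : s ∈ Icc (0 : ℝ) 1)
    (ht : t ∈ Icc (0 : ℝ) 1) (hst : s < t) :
    (s ∈ Icc P.c P.d ∧ t ∈ Icc P.c P.d ∧ t - s ≤ P.ρ) ∨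
      |P.primitive a t - P.primitive a s| ≤ ‖a‖ / 2 * ‖α t - α s‖ := by
  rcases lt_or_ge P.ρ (t - s) with h | h
  · refine Or.inr ((P.abs_primitive_sub_le a hst.le).trans ?_)
    nlinarith [mul_le_mul_of_nonneg_left (P.far s hs t ht h) (norm_nonneg a)]
  -- Either `[s, t]` misses the support of the density, or both ends are within `ρ` of `[t₁, t₂]`
  -- and so lie in `[c, d]`.
  · by_cases h1 : t < P.t₁ ∨ P.t₂ < s
    · refine Or.inr ?_
      rw [P.primitive_eq a hst.le h1, sub_self, abs_zero]
      positivity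
    · push Not at h1
      have := P.c_add_le
      have := P.add_le_d
      exact Or.inl ⟨⟨by linarith, by linarith⟩, ⟨by linarith, by linarith⟩, h⟩

theorem eventually_mem_Icc {u : ℝ} (hu : u ∈ Icc P.c P.d) : ∀ᶠ v in 𝓝 u, v ∈ Icc (0 : ℝ) 1 :=
  Icc_mem_nhds (P.Icc_subset hu).1 (P.Icc_subset hu).2

theorem abs_primitive_sub_le_norm_mul_of_lt (a : EllInfty) {s t : ℝ} (hs : s ∈ Icc (0 : ℝ) 1)
    (ht : t ∈ Icc (0 : ℝ) 1) (hst : s < t) :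
    |P.primitive a t - P.primitive a s| ≤ ‖a‖ * ‖α t - α s‖ := by
  rcases P.near_or_abs_primitive_sub_le a hs ht hst with ⟨hs', ht', hρ⟩ | h
  · rcases eq_or_ne a 0 with rfl | ha
    · simpa using P.abs_primitive_sub_le 0 hst.le
    · obtain ⟨η, hη, hosc, hvol⟩ := P.porous s hs' t ht' hst hρ
      refine (abs_sub_lt_mul_norm_sub P.measurableSet hst
        (fun u hu => P.hasDerivAt u ⟨hs'.1.trans hu.1, hu.2.trans ht'.2⟩) hη P.m_pos
        (P.m_le s hs') hosc hvol
        ((P.lipschitzWith_primitive a).lipschitzOnWith.absolutelyContinuousOnInterval)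
        (norm_pos_iff.2 ha) ?_ ?_).le
      · filter_upwards [P.ae_hasDerivAt_primitive a] with u hu _
        rw [hu.deriv]
        exact P.abs_density_le a u
      · filter_upwards [P.ae_hasDerivAt_primitive a] with u hu _ huA
        rw [hu.deriv, density, indicator_of_notMem huA, abs_zero]
        positivity
  · refine h.trans (mul_le_mul_of_nonneg_right ?_ (norm_nonneg _))
    linarith [norm_nonneg a]

theorem abs_primitive_sub_le_norm_mul (a : EllInfty) {s t : ℝ} (hs : s ∈ Icc (0 : ℝ) 1)
    (ht : t ∈ Icc (0 : ℝ) 1) :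
    |P.primitive a t - P.primitive a s| ≤ ‖a‖ * ‖α t - α s‖ := by
  rcases lt_trichotomy s t with h | rfl | h
  · exact P.abs_primitive_sub_le_norm_mul_of_lt a hs ht h
  · simp
  · rw [abs_sub_comm, norm_sub_rev]
    exact P.abs_primitive_sub_le_norm_mul_of_lt a ht hs h

/-- Each piece of `A` has positive measure, so it contains a point where the primitive has
derivative `a n * ‖α'‖`; comparison with `‖α'‖ > 0` there gives `|a n| ≤ K`. -/
theorem norm_le_of_abs_primitive_sub_le (a : EllInfty) {K : ℝ} (hK : 0 ≤ K)
    (h : ∀ s ∈ Icc (0 : ℝ) 1, ∀ t ∈ Icc (0 : ℝ) 1,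
      |P.primitive a t - P.primitive a s| ≤ K * ‖α t - α s‖) : ‖a‖ ≤ K := by
  refine lp.norm_le_of_forall_le hK fun n => ?_
  obtain ⟨u, ⟨huA, hun⟩, hu⟩ : ∃ u ∈ P.A ∩ P.idx ⁻¹' {n},
      HasDerivAt (P.primitive a) (P.density a u) u := by
    by_contra! hc
    refine (P.volume_pos n).ne' (measure_mono_null ?_ (ae_iff.1 (P.ae_hasDerivAt_primitive a)))
    exact fun u hu => hc u hu
  have huc := P.A_subset huA
  have h1 := norm_deriv_le_of_norm_sub_le (K := K) (P.hasDerivAt u huc) hu <| by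
    filter_upwards [P.eventually_mem_Icc huc] with v hv
    exact h u (Ioo_subset_Icc_self (P.Icc_subset huc)) v hv
  rw [density, indicator_of_mem huA, hun, norm_mul, norm_norm] at h1
  exact le_of_mul_le_mul_right h1 (P.m_pos.trans_le (P.m_le u huc))

/-- The half slope off `A` needed for the strict chord estimate survives a perturbation of size `‖a‖
/ 4`. Applied with `K` the norm of the perturbed function, this excludes norm attainment. -/
theorem abs_sub_lt_of_close_of_lt {a : EllInfty} (ha : a ≠ 0) {G : ℝ → ℝ} {K : ℝ}
    (hK : 3 / 4 * ‖a‖ < K)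
    (hG : ∀ s ∈ Icc (0 : ℝ) 1, ∀ t ∈ Icc (0 : ℝ) 1, |G t - G s| ≤ K * ‖α t - α s‖)
    (hGa : ∀ s ∈ Icc (0 : ℝ) 1, ∀ t ∈ Icc (0 : ℝ) 1,
      |(G t - P.primitive a t) - (G s - P.primitive a s)| ≤ ‖a‖ / 4 * ‖α t - α s‖)
    {s t : ℝ} (hs : s ∈ Icc (0 : ℝ) 1) (ht : t ∈ Icc (0 : ℝ) 1) (hst : s < t)
    (hα : 0 < ‖α t - α s‖) : |G t - G s| < K * ‖α t - α s‖ := by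
  have ha0 : 0 < ‖a‖ := norm_pos_iff.2 ha
  have hK0 : 0 < K := by linarith
  rcases P.near_or_abs_primitive_sub_le a hs ht hst with ⟨hs', ht', hρ⟩ | h
  · obtain ⟨η, hη, hosc, hvol⟩ := P.porous s hs' t ht' hst hρ
    have hsub : Icc s t ⊆ Icc P.c P.d := Icc_subset_Icc hs'.1 ht'.2
    have hsub' : Icc s t ⊆ Icc 0 1 := Icc_subset_Icc hs.1 ht.2
    have hac : AbsolutelyContinuousOnInterval G s t := by
      obtain ⟨L, hL⟩ := P.lipschitz
      refine LipschitzOnWith.absolutelyContinuousOnInterval (K := K.toNNReal * L) ?_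
      rw [uIcc_of_le hst.le]
      refine LipschitzOnWith.of_dist_le_mul fun x hx y hy => ?_
      rw [NNReal.coe_mul, Real.coe_toNNReal K hK0.le, mul_assoc]
      refine (hG y (hsub' hy) x (hsub' hx)).trans (mul_le_mul_of_nonneg_left ?_ hK0.le)
      rw [← dist_eq_norm]
      exact hL.dist_le_mul x (hsub' hx) y (hsub' hy)
    have hdiff := hac.ae_differentiableAt
    rw [uIcc_of_le hst.le] at hdiff
    refine abs_sub_lt_mul_norm_sub P.measurableSet hst (fun u hu => P.hasDerivAt u (hsub hu)) hη
      P.m_pos (P.m_le s hs') hosc hvol hac hK0 ?_ ?_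
    · filter_upwards [hdiff] with u hu hu'
      refine norm_deriv_le_of_norm_sub_le (P.hasDerivAt u (hsub hu')) (hu hu').hasDerivAt ?_
      filter_upwards [P.eventually_mem_Icc (hsub hu')] with v hv
      exact hG u (hsub' hu') v hv
    -- Off `A` the primitive has derivative `0` almost everywhere, so `G'` is the derivative of the
    -- perturbation alone, and `‖a‖ / 4 ≤ K / 2`.
    · filter_upwards [hdiff, P.ae_hasDerivAt_primitive a] with u hu hua hu' huA
      rw [density, indicator_of_notMem huA] at hua
      have h1 := norm_deriv_le_of_norm_sub_le (K := ‖a‖ / 4) (P.hasDerivAt u (hsub hu'))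
        ((hu hu').hasDerivAt.sub hua) <| by
          filter_upwards [P.eventually_mem_Icc (hsub hu')] with v hv
          exact hGa u (hsub' hu') v hv
      rw [sub_zero] at h1
      exact h1.trans (mul_le_mul_of_nonneg_right (by linarith) (norm_nonneg _))
  · have h1 := hGa s hs t ht
    have h2 : G t - G s = ((G t - P.primitive a t) - (G s - P.primitive a s))
        + (P.primitive a t - P.primitive a s) := by ring
    have h3 := abs_add_le ((G t - P.primitive a t) - (G s - P.primitive a s))
      (P.primitive a t - P.primitive a s)
    rw [← h2] at h3
    -- The slopes add up to at most `‖a‖ / 4 + ‖a‖ / 2 < K`; strictness needs the nonzero chord.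
    nlinarith

theorem abs_sub_lt_of_close {a : EllInfty} (ha : a ≠ 0) {G : ℝ → ℝ} {K : ℝ}
    (hK : 3 / 4 * ‖a‖ < K)
    (hG : ∀ s ∈ Icc (0 : ℝ) 1, ∀ t ∈ Icc (0 : ℝ) 1, |G t - G s| ≤ K * ‖α t - α s‖)
    (hGa : ∀ s ∈ Icc (0 : ℝ) 1, ∀ t ∈ Icc (0 : ℝ) 1,
      |(G t - P.primitive a t) - (G s - P.primitive a s)| ≤ ‖a‖ / 4 * ‖α t - α s‖)
    {s t : ℝ} (hs : s ∈ Icc (0 : ℝ) 1) (ht : t ∈ Icc (0 : ℝ) 1) (hα : 0 < ‖α t - α s‖) :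
    |G t - G s| < K * ‖α t - α s‖ := by
  rcases lt_trichotomy s t with h | rfl | h
  · exact P.abs_sub_lt_of_close_of_lt ha hK hG hGa hs ht h hα
  · simp at hα
  · rw [norm_sub_rev] at hα ⊢
    rw [abs_sub_comm]
    exact P.abs_sub_lt_of_close_of_lt ha hK hG hGa ht hs h hα

end PorousSet

end Curve

/-! ### Transfer to the Lipschitz space of the curve -/

theorem LipZero.sub_apply {M : Type*} [MetricSpace M] {x₀ : M} (f g : LipZero M x₀) (p : M) :
    (f - g) p = f p - g p := rfl

theorem LipZero.abs_sub_le_norm_mul_dist {M : Type*} [MetricSpace M] {x₀ : M} (f : LipZero M x₀)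
    (p q : M) : |f q - f p| ≤ ‖f‖ * dist p q := by
  rcases eq_or_ne p q with rfl | hpq
  · simp
  · have h := f.abs_lipSlope_le_norm hpq
    rwa [lipSlope, abs_div, abs_of_pos (dist_pos.2 hpq), div_le_iff₀ (dist_pos.2 hpq)] at h

/-- A linear map into `Lip₀(M)` given by a linear family of functions, corrected by constants. -/
noncomputable def LipZero.linearMapOfLipschitz {X M : Type*} [NormedAddCommGroup X]
    [NormedSpace ℝ X] [MetricSpace M] (x₀ : M) (Φ : X →ₗ[ℝ] M → ℝ)
    (hΦ : ∀ a p q, |Φ a q - Φ a p| ≤ ‖a‖ * dist p q) : X →ₗ[ℝ] LipZero M x₀ where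
  toFun a := (⟨fun p => Φ a p - Φ a x₀, ⟨‖a‖₊, LipschitzWith.of_dist_le_mul fun p q => by
    rw [Real.dist_eq, sub_sub_sub_cancel_right, coe_nnnorm, dist_comm]
    exact hΦ a q p⟩, sub_self _⟩ : lipZeroSubmodule M x₀)
  map_add' a b := LipZero.ext fun p => by
    change Φ (a + b) p - Φ (a + b) x₀ = (Φ a p - Φ a x₀) + (Φ b p - Φ b x₀)
    simp only [map_add, Pi.add_apply]
    ring
  map_smul' k a := LipZero.ext fun p => by
    change Φ (k • a) p - Φ (k • a) x₀ = k * (Φ a p - Φ a x₀)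
    simp only [map_smul, Pi.smul_apply, smul_eq_mul]
    ring

theorem mainTheorem6 {E : Type*} [NormedAddCommGroup E] [NormedSpace ℝ E]
    (α : ℝ → E) (hα : ContDiffOn ℝ 1 α (Set.Icc 0 1)) (hinj : Set.InjOn α (Set.Icc 0 1))
    (hderiv : ∃ t ∈ Set.Icc (0 : ℝ) 1, derivWithin α (Set.Icc 0 1) t ≠ 0)
    (Γ : Set E) (hΓ : Γ = α '' Set.Icc 0 1) (x₀ : Γ) :
    IsometricallyContains ((Set.univ \ closure (SNA Γ x₀)) ∪ {0}) EllInfty := by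
  obtain ⟨P⟩ := nonempty_porousSet hα hinj hderiv
  have hτ : ∀ p : Γ, ∃ t ∈ Icc (0 : ℝ) 1, α t = p := fun p =>
    hΓ.subset p.2
  -- `τ` gives the parameter of a point of the curve, and `γ` below inverts it on `[0, 1]`, by
  -- injectivity of `α`.
  choose τ hτI hτ using hτ
  have : Nonempty Γ := ⟨x₀⟩
  have hγ : ∀ t ∈ Icc (0 : ℝ) 1, ∃ p : Γ, τ p = t := fun t ht =>
    ⟨⟨α t, hΓ ▸ mem_image_of_mem α ht⟩, hinj (hτI _) ht (hτ _)⟩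
  choose! γ hγ using hγ
  have hdist : ∀ p q : Γ, dist p q = ‖α (τ q) - α (τ p)‖ := fun p q => by
    rw [hτ, hτ, ← dist_eq_norm, dist_comm, Subtype.dist_eq]
  let Φ : EllInfty →ₗ[ℝ] Γ → ℝ :=
    { toFun := fun a p => P.primitive a (τ p)
      map_add' := fun a b => by rw [P.primitive_add]; rfl
      map_smul' := fun k a => by rw [P.primitive_smul]; rfl }
  have hΦ : ∀ a p q, |Φ a q - Φ a p| ≤ ‖a‖ * dist p q := fun a p q => by
    rw [hdist]
    exact P.abs_primitive_sub_le_norm_mul a (hτI p) (hτI q)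
  let T := LipZero.linearMapOfLipschitz x₀ Φ hΦ
  have hTsub : ∀ a p q, T a q - T a p = P.primitive a (τ q) - P.primitive a (τ p) :=
    fun a p q => sub_sub_sub_cancel_right _ _ _
  have hnorm : ∀ a, ‖T a‖ = ‖a‖ := fun a => by
    refine le_antisymm ((T a).norm_le_of_forall (norm_nonneg a) fun p q hpq => ?_)
      (P.norm_le_of_abs_primitive_sub_le a (norm_nonneg _) fun s hs t ht => ?_)
    · rw [lipSlope, abs_div, abs_of_pos (dist_pos.2 hpq), div_le_iff₀ (dist_pos.2 hpq), hTsub]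
      exact hΦ a p q
    · rw [← hγ s hs, ← hγ t ht, ← hTsub, ← hdist]
      exact (T a).abs_sub_le_norm_mul_dist _ _
  refine ⟨⟨T, hnorm⟩, ?_⟩
  rintro _ ⟨a, rfl⟩
  change T a ∈ _
  rcases eq_or_ne a 0 with rfl | ha
  · exact Or.inr (map_zero T)
  refine Or.inl ⟨mem_univ _, fun hcl => ?_⟩
  have ha0 : 0 < ‖a‖ := norm_pos_iff.2 ha
  obtain ⟨g, ⟨p, q, hpq, hg⟩, hgT⟩ := Metric.mem_closure_iff.1 hcl (‖a‖ / 4) (by positivity)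
  rw [dist_comm, dist_eq_norm] at hgT
  -- Isometry of `T` and the distance `‖a‖ / 4` give this by the triangle inequality.
  have hK : 3 / 4 * ‖a‖ < ‖g‖ := by
    have := norm_le_norm_add_norm_sub g (T a)
    rw [hnorm] at this
    linarith
  have hγτ : ∀ p, γ (τ p) = p := fun p => Subtype.ext <| by
    rw [← hτ, hγ _ (hτI p), hτ]
  have hγdist : ∀ s ∈ Icc (0 : ℝ) 1, ∀ t ∈ Icc (0 : ℝ) 1, dist (γ s) (γ t) = ‖α t - α s‖ :=
    fun s hs t ht => by rw [hdist, hγ s hs, hγ t ht]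
  have key := P.abs_sub_lt_of_close ha (G := fun t => g (γ t)) hK
    (fun s hs t ht => by
      rw [← hγdist s hs t ht]
      exact g.abs_sub_le_norm_mul_dist _ _)
    (fun s hs t ht => by
      rw [← hγdist s hs t ht]
      refine le_trans (le_of_eq ?_) (((g - T a).abs_sub_le_norm_mul_dist (γ s) (γ t)).trans
        (mul_le_mul_of_nonneg_right hgT.le dist_nonneg))
      have h := hTsub a (γ s) (γ t)
      rw [hγ s hs, hγ t ht] at h
      rw [LipZero.sub_apply, LipZero.sub_apply]
      congr 1
      linarith)
    (hτI p) (hτI q) (by rw [← hdist]; exact dist_pos.2 hpq)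
  rw [← hdist] at key
  simp only [hγτ] at key
  rw [lipSlope, abs_div, abs_of_pos (dist_pos.2 hpq), div_eq_iff (dist_pos.2 hpq).ne'] at hg
  exact key.ne hg
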